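/- Let $f:\mathbb{R}^n\to\mathbb{R}^n$ be continuously differentiable and let $g:\mathbb{R}^n\to\mathbb{R}^{n\times m}$ be smooth. Put $F(x,u)=f(x)+g(x)u$ and consider the extended system $\dot x=f(x)+g(x)u$, $\dot u=0$. Let $\mathcal M\subset\mathbb{R}^{n+m}$ be a compact set that is forward invariant for it, i.e. from every point $z=(x,u)\in\mathcal M$ the solution $t\mapsto S^t(z)$ exists for all $t\ge 0$ and stays in $\mathcal M$. Let $U^t\varphi=\varphi\circ S^t$ be the Koopman operator, and for $\lambda,T_{\max}>0$ let $$L_{\lambda,T_{\max}}\varphi=\lambda^2\int_0^{T_{\max}}e^{-\lambda t}\,U^t\varphi\,dt-\lambda\varphi$$ be the truncated Yosida approximation of the Koopman generator. Let $\varphi_1,\varphi_2,\dots$ be an enumeration of all monomials $\prod_{j=1}^n x_j^{p_j}\prod_{l=1}^m u_l^{q_l}$ with $p_j,q_l\in\mathbb{N}=\{0,1,2,\dots\}$ and $\sum_l q_l\le 1$, and let $\mathcal F_N=\mathrm{span}\{\varphi_1,\dots,\varphi_N\}$. Let $\|h\|_\infty=\sup_{z\in\mathcal M}|h(z)|$.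 An $N$-dimensional approximation $L_{\lambda,T_{\max},N}$ of $L_{\lambda,T_{\max}}$ is given by an $N\times N$ matrix $A=A_{\lambda,T_{\max},N}$ such that for every $i\le N$ the function $L_{\lambda,T_{\max},N}\varphi_i:=\sum_{k=1}^N\varphi_k A_{k,i}$ is a best approximation of $L_{\lambda,T_{\max}}\varphi_i$ in $\mathcal F_N$ with respect to $\|\cdot\|_\infty$. The vector field $F_{\lambda,T_{\max},N}$ read off from it has the components $$\bigl(F_{\lambda,T_{\max},N}\bigr)_j(x,u)=\sum_{k=1}^N\varphi_k(x,u)\,A_{k,i_j},\qquad j=1,\dots,n,$$ where $i_j$ is the index with $\varphi_{i_j}=x_j$ (defined once $N\ge i_j$; set to $0$ otherwise). Then such approximations exist for all $\lambda,T_{\max}>0$ and all $N$, and for every choice of them $$F_{\lambda,T_{\max},N}\to F\quad\text{uniformly on }\mathcal M\quad\text{as }\lambda\to\infty,\ T_{\max}\to\infty,\ N\to\infty\text{ simultaneously,}$$ i.e. for every $\varepsilon>0$ there are $\lambda_0,T_0,N_0$ such that $\sup_{\mathcal M}\|F_{\lambda,T_{\max},N}-F\|<\varepsilon$ for all $\lambda\ge\lambda_0$,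 $T_{\max}\ge T_0$, $N\ge N_0$. -/

import Mathlib

open Filter
open scoped ENNReal ContDiff

noncomputable section

namespace KoopmanId

/-- Extended states `(x, u) ∈ ℝⁿ × ℝᵐ`. -/
abbrev ExtState (n m : ℕ) : Type :=
  EuclideanSpace ℝ (Fin n) × EuclideanSpace ℝ (Fin m)

/-- The control-affine vector field `F(x, u) = f(x) + g(x) u`. -/
def vectorField {n m : ℕ} (f : EuclideanSpace ℝ (Fin n) → EuclideanSpace ℝ (Fin n))
    (g : EuclideanSpace ℝ (Fin n) → Matrix (Fin n) (Fin m) ℝ) (z : ExtState n m) :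
    EuclideanSpace ℝ (Fin n) :=
  f z.1 + WithLp.toLp 2 ((g z.1).mulVec (WithLp.ofLp z.2))

/-- The right-hand side of the extended system `ẋ = f(x) + g(x) u`, `u̇ = 0`. -/
def extField {n m : ℕ} (f : EuclideanSpace ℝ (Fin n) → EuclideanSpace ℝ (Fin n))
    (g : EuclideanSpace ℝ (Fin n) → Matrix (Fin n) (Fin m) ℝ) (z : ExtState n m) :
    ExtState n m :=
  (vectorField f g z, 0)

/-- `γ` solves `ż = V(z)`, `z(0) = z₀` on `[0, ∞)`. -/
def IsForwardSolution {n m : ℕ} (V : ExtState n m → ExtState n m) (z₀ : ExtState n m)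
    (γ : ℝ → ExtState n m) : Prop :=
  γ 0 = z₀ ∧ IsIntegralCurveOn γ (fun _ => V) (Set.Ici 0)

/-- `M` is (forward) invariant: from each point of `M` the solution exists on `[0, ∞)` and stays
in `M`. (For the locally Lipschitz fields considered here the solution is unique.) -/
def IsInvariantSet {n m : ℕ} (V : ExtState n m → ExtState n m) (M : Set (ExtState n m)) : Prop :=
  ∀ z₀ ∈ M, ∃ γ : ℝ → ExtState n m, IsForwardSolution V z₀ γ ∧ ∀ t : ℝ, 0 ≤ t → γ t ∈ M

open Classical in
/-- The flow `Sᵗ(z)` for `t ≥ 0`: the value at time `t` of the solution starting from `z`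
(with the irrelevant value `z` where there is no solution on `[0, ∞)`). -/
def flow {n m : ℕ} (V : ExtState n m → ExtState n m) (t : ℝ) (z : ExtState n m) : ExtState n m :=
  if h : ∃ γ : ℝ → ExtState n m, IsForwardSolution V z γ then h.choose t else z

/-- The Koopman operator `(Uᵗ φ)(z) = φ(Sᵗ(z))`. -/
def koopman {n m : ℕ} (V : ExtState n m → ExtState n m) (t : ℝ) (φ : ExtState n m → ℝ) :
    ExtState n m → ℝ :=
  fun z => φ (flow V t z)

/-- The truncated Yosida approximation of the generator,
`L_{lam,T} φ = lam² ∫₀ᵀ e^{-lam t} Uᵗ φ dt - lam φ`. -/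
def yosidaTrunc {n m : ℕ} (V : ExtState n m → ExtState n m) (lam T : ℝ) (φ : ExtState n m → ℝ) :
    ExtState n m → ℝ :=
  fun z => lam ^ 2 * (∫ t in (0 : ℝ)..T, Real.exp (-lam * t) * koopman V t φ z) - lam * φ z

/-- Exponents `(p, q)` of the monomials that are at most linear in the input: `∑ q_l ≤ 1`. -/
abbrev ObsIndex (n m : ℕ) : Type :=
  {pq : (Fin n → ℕ) × (Fin m → ℕ) // ∑ l, pq.2 l ≤ 1}

/-- The observable `∏ x_j ^ p_j * ∏ u_l ^ q_l`. -/
def observable {n m : ℕ} (a : ObsIndex n m) (z : ExtState n m) : ℝ :=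
  (∏ j, z.1 j ^ a.1.1 j) * ∏ l, z.2 l ^ a.1.2 l

/-- The exponents of the coordinate observable `x_j`. -/
def coordIndex {n m : ℕ} (j : Fin n) : ObsIndex n m :=
  ⟨(Pi.single j 1, 0), by simp⟩

/-- The uniform norm `sup_{z ∈ M} |h z|`, in `[0, ∞]`. -/
def supNorm {n m : ℕ} (M : Set (ExtState n m)) (h : ExtState n m → ℝ) : ℝ≥0∞ :=
  ⨆ z ∈ M, ‖h z‖ₑ

/-- The element `∑ c_k φ_k` of the span `𝓕_N` of the first `N` observables in the
enumeration `σ`. -/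
def obsSum {n m : ℕ} (σ : ℕ → ObsIndex n m) {N : ℕ} (c : Fin N → ℝ) (z : ExtState n m) : ℝ :=
  ∑ k : Fin N, observable (σ k) z * c k

/-- `A` is the matrix of an `N`-dimensional approximation `L_{lam,T,N} : 𝓕_N → 𝓕_N` of `L_{lam,T}`:
for each basis observable `φ_i`, the element `L_{lam,T,N} φ_i = ∑ φ_k A_{k,i}` of `𝓕_N` is a best
approximation of `L_{lam,T} φ_i` in `𝓕_N` for the uniform norm on `M`. -/
def IsFiniteDimApprox {n m : ℕ} (V : ExtState n m → ExtState n m) (M : Set (ExtState n m))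
    (σ : ℕ → ObsIndex n m) (lam T : ℝ) (N : ℕ) (A : Matrix (Fin N) (Fin N) ℝ) : Prop :=
  ∀ (i : Fin N) (c : Fin N → ℝ),
    supNorm M (fun z => yosidaTrunc V lam T (observable (σ i)) z - obsSum σ (fun k => A k i) z) ≤
      supNorm M (fun z => yosidaTrunc V lam T (observable (σ i)) z - obsSum σ c z)

open Classical in
/-- The vector field read off from the matrix `A` of the approximate generator: its `j`-th component
is `∑ φ_k(x, u) A_{k,i}`, where `i` is the index with `φ_i = x_j` (and, by convention, `0` if `N` is
so small that no such index occurs among the first `N`). -/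
def recoveredField {n m : ℕ} (σ : ℕ → ObsIndex n m) {N : ℕ} (A : Matrix (Fin N) (Fin N) ℝ)
    (z : ExtState n m) : EuclideanSpace ℝ (Fin n) :=
  WithLp.toLp 2 fun j =>
    if h : ∃ i : Fin N, σ i = coordIndex j then obsSum σ (fun k => A k h.choose) z else 0

end KoopmanId

end

/-!
Why the recovered fields converge. Since `C¹` fields are locally Lipschitz, solutions are unique and
`flow` is the solution that stays in the compact set `M`. There the field `V` is bounded and
Lipschitz, so `Sᵗ z = z + t V(z) + O(t²)` uniformly in `z ∈ M` and in *all* `t ≥ 0`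
(`exists_norm_flow_sub_le`). Inserting this into the Laplace average, whose affine part can be
integrated explicitly, shows that the truncated Yosida approximation maps the observable `x_j` to
`F_j + O(1 / lam)`, uniformly on `M` and in `T ≥ 1` (`exists_abs_yosidaTrunc_sub_le`).

For the passage to `N` dimensions, best approximations exist because the span of finitely many
bounded functions on `M` is a proper space (`exists_supNorm_sub_obsSum_le`). By Stone–Weierstrass,
applied to the components of `f` and to the entries of `g`, each `F_j` is a uniform limit of
combinations of observables; that `F` is affine in `u` is what makes the restriction to monomials
with `∑ q_l ≤ 1` harmless (`exists_mem_span_near_vectorField`). A best approximation of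
`L_{lam,T} x_j` is no worse than such a combination, so its distance from `F_j` is at most
`dist(F_j, 𝓕_N) + 2 * O(1 / lam)` (`abs_recoveredField_sub_le`). The two errors depend on `N` and on
`lam`, `T` separately, which is why the three limits may be taken simultaneously.
-/

/-! ### The control-affine field -/

namespace KoopmanId

variable {n m : ℕ}

theorem contDiff_vectorField
    {f : EuclideanSpace ℝ (Fin n) → EuclideanSpace ℝ (Fin n)}
    {g : EuclideanSpace ℝ (Fin n) → Matrix (Fin n) (Fin m) ℝ}
    (hf : ContDiff ℝ 1 f) (hg : ∀ i j, ContDiff ℝ 1 (fun x => g x i j)) :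
    ContDiff ℝ 1 (vectorField f g) := by
  rw [contDiff_euclidean] at hf ⊢
  intro i
  have hu : ∀ l, ContDiff ℝ 1 (fun z : ExtState n m => z.2 l) := fun l =>
    contDiff_euclidean.1 contDiff_snd l
  have h : ContDiff ℝ 1 (fun z : ExtState n m => f z.1 i + ∑ l, g z.1 i l * z.2 l) :=
    ((hf i).comp contDiff_fst).add
      (ContDiff.sum fun l _ => ((hg i l).comp contDiff_fst).mul (hu l))
  exact h

/-! ### Flow of the extended system -/

theorem IsForwardSolution.eqOn {V : ExtState n m → ExtState n m} (hV : LocallyLipschitz V)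
    {z₀ : ExtState n m} {γ δ : ℝ → ExtState n m} (hγ : IsForwardSolution V z₀ γ)
    (hδ : IsForwardSolution V z₀ δ) : Set.EqOn γ δ (Set.Ici 0) := by
  intro T hT
  have hcont : ∀ {α : ℝ → ExtState n m}, IsForwardSolution V z₀ α →
      ContinuousOn α (Set.Icc 0 T) := fun hα t ht =>
    ((hα.2 t ht.1).continuousWithinAt).mono Set.Icc_subset_Ici_self
  have hderiv : ∀ {α : ℝ → ExtState n m}, IsForwardSolution V z₀ α →
      ∀ t ∈ Set.Ico 0 T, HasDerivWithinAt α (V (α t)) (Set.Ici t) t := fun hα t ht =>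
    (hα.2 t ht.1).mono (Set.Ici_subset_Ici.2 ht.1)
  obtain ⟨K, hK⟩ := (hV.locallyLipschitzOn
    (s := γ '' Set.Icc 0 T ∪ δ '' Set.Icc 0 T)).exists_lipschitzOnWith_of_compact
    ((isCompact_Icc.image_of_continuousOn (hcont hγ)).union
      (isCompact_Icc.image_of_continuousOn (hcont hδ)))
  exact ODE_solution_unique_of_mem_Icc_right (v := fun _ => V) (fun _ _ => hK)
    (hcont hγ) (hderiv hγ)
    (fun t ht => Or.inl (Set.mem_image_of_mem _ (Set.Ico_subset_Icc_self ht)))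
    (hcont hδ) (hderiv hδ)
    (fun t ht => Or.inr (Set.mem_image_of_mem _ (Set.Ico_subset_Icc_self ht)))
    (hγ.1.trans hδ.1.symm) ⟨hT, le_rfl⟩

/-- The flow is defined by an arbitrary choice of solution; by uniqueness it is *the* solution. -/
theorem IsForwardSolution.flow_eq {V : ExtState n m → ExtState n m} (hV : LocallyLipschitz V)
    {z₀ : ExtState n m} {γ : ℝ → ExtState n m} (hγ : IsForwardSolution V z₀ γ) {t : ℝ}
    (ht : 0 ≤ t) : flow V t z₀ = γ t := by
  have h : ∃ γ : ℝ → ExtState n m, IsForwardSolution V z₀ γ := ⟨γ, hγ⟩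
  rw [flow, dif_pos h]
  exact h.choose_spec.eqOn hV hγ ht

theorem IsInvariantSet.isForwardSolution_flow {V : ExtState n m → ExtState n m}
    (hV : LocallyLipschitz V) {M : Set (ExtState n m)} (hM : IsInvariantSet V M)
    {z : ExtState n m} (hz : z ∈ M) :
    IsForwardSolution V z (fun t => flow V t z) ∧ ∀ t : ℝ, 0 ≤ t → flow V t z ∈ M := by
  obtain ⟨γ, hγ, hγM⟩ := hM z hz
  have heq : ∀ t : ℝ, 0 ≤ t → flow V t z = γ t := fun t ht => hγ.flow_eq hV ht
  refine ⟨⟨(heq 0 le_rfl).trans hγ.1, fun t ht => ?_⟩, fun t ht => heq t ht ▸ hγM t ht⟩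
  have h := (hγ.2 t ht).congr (f₁ := fun t => flow V t z) (fun s hs => heq s hs) (heq t ht)
  simpa only [heq t ht] using h

/-- The first-order Taylor expansion of the flow holds with a quadratic error which is uniform
over the invariant set and over *all* times: the field is bounded and Lipschitz along orbits. -/
theorem exists_norm_flow_sub_le {V : ExtState n m → ExtState n m} (hV : LocallyLipschitz V)
    {M : Set (ExtState n m)} (hM : IsCompact M) (hinv : IsInvariantSet V M) :
    ∃ K : ℝ, 0 ≤ K ∧ ∀ z ∈ M, ∀ t : ℝ, 0 ≤ t →
      ‖flow V t z - (z + t • V z)‖ ≤ K * t ^ 2 := by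
  obtain ⟨L, hL⟩ := (hV.locallyLipschitzOn (s := M)).exists_lipschitzOnWith_of_compact hM
  obtain ⟨B, hB⟩ := hM.exists_bound_of_continuousOn hV.continuous.continuousOn
  refine ⟨L * |B|, by positivity, fun z hz t ht => ?_⟩
  obtain ⟨⟨h0, hderiv⟩, hmem⟩ := hinv.isForwardSolution_flow hV hz
  have hlin : ∀ s : ℝ, 0 ≤ s → ‖flow V s z - z‖ ≤ |B| * s := by
    intro s hs
    have h := (convex_Ici (0 : ℝ)).norm_image_sub_le_of_norm_hasDerivWithin_le
      (f := fun t => flow V t z) (C := |B|) hderiv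
      (fun r hr => (hB _ (hmem r hr)).trans (le_abs_self B)) (Set.self_mem_Ici) hs
    simpa only [h0, sub_zero, Real.norm_of_nonneg hs] using h
  have h := (convex_Icc (0 : ℝ) t).norm_image_sub_le_of_norm_hasDerivWithin_le
    (f := fun s => flow V s z - s • V z) (f' := fun s => V (flow V s z) - V z)
    (C := L * (|B| * t))
    (fun s hs => by
      have h1 : HasDerivWithinAt (fun s => flow V s z) (V (flow V s z)) (Set.Icc 0 t) s :=
        (hderiv s hs.1).mono Set.Icc_subset_Ici_self
      have h2 : HasDerivWithinAt (fun s : ℝ => s • V z) (V z) (Set.Icc 0 t) s := by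
        simpa only [one_smul] using ((hasDerivAt_id' s).smul_const (V z)).hasDerivWithinAt
      exact h1.sub h2)
    (fun s hs => by
      refine (hL.norm_sub_le (hmem s hs.1) hz).trans ?_
      have := (hlin s hs.1).trans (mul_le_mul_of_nonneg_left hs.2 (abs_nonneg B))
      gcongr)
    (Set.left_mem_Icc.2 ht) (Set.right_mem_Icc.2 ht)
  simp only [h0, zero_smul, sub_zero, Real.norm_of_nonneg ht] at h
  calc ‖flow V t z - (z + t • V z)‖ = ‖flow V t z - t • V z - z‖ := by congr 1; abel
    _ ≤ L * (|B| * t) * t := h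
    _ = L * |B| * t ^ 2 := by ring

end KoopmanId

/-! ### Laplace averages of scalar functions -/

theorem integral_exp_neg_mul_quadratic {lam : ℝ} (hlam : lam ≠ 0) (a b c T : ℝ) :
    ∫ t in (0 : ℝ)..T, Real.exp (-lam * t) * (a + b * t + c * t ^ 2) =
      a / lam + b / lam ^ 2 + 2 * c / lam ^ 3 - Real.exp (-lam * T) *
        ((a + b * T + c * T ^ 2) / lam + (b + 2 * c * T) / lam ^ 2 + 2 * c / lam ^ 3) := by
  have hderiv : ∀ t : ℝ, HasDerivAt (fun t => -(Real.exp (-lam * t) *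
        ((a + b * t + c * t ^ 2) / lam + (b + 2 * c * t) / lam ^ 2 + 2 * c / lam ^ 3)))
      (Real.exp (-lam * t) * (a + b * t + c * t ^ 2)) t := by
    intro t
    have h1 : HasDerivAt (fun t => Real.exp (-lam * t)) (Real.exp (-lam * t) * (-lam)) t := by
      simpa using ((hasDerivAt_id t).const_mul (-lam)).exp
    have h2 : HasDerivAt (fun t => a + b * t + c * t ^ 2) (b + 2 * c * t) t := by
      refine ((((hasDerivAt_id' t).const_mul b).const_add a).add
        ((hasDerivAt_pow 2 t).const_mul c)).congr_deriv ?_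
      push_cast
      ring
    have h3 : HasDerivAt (fun t => b + 2 * c * t) (2 * c) t := by
      simpa using ((hasDerivAt_id t).const_mul (2 * c)).const_add b
    refine (h1.mul (((h2.div_const lam).add (h3.div_const (lam ^ 2))).add_const
      (2 * c / lam ^ 3))).neg.congr_deriv ?_
    simp only [Pi.add_apply]
    field_simp
    ring
  rw [intervalIntegral.integral_eq_sub_of_hasDerivAt (fun t _ => hderiv t)
    (Continuous.intervalIntegrable (by fun_prop) _ _)]
  simp
  ring

theorem sq_mul_exp_neg_le {y : ℝ} (hy : 0 ≤ y) : y ^ 2 * Real.exp (-y) ≤ 2 := by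
  rw [Real.exp_neg, ← div_eq_mul_inv, div_le_iff₀ (Real.exp_pos y)]
  linarith [Real.quadratic_le_exp_of_nonneg hy]

/-- One-sided form of `abs_yosida_sub_le`. -/
theorem yosida_sub_le {x : ℝ → ℝ} {a b K lam T : ℝ} (hlam : 1 ≤ lam) (hT : 1 ≤ T) (hK : 0 ≤ K)
    (hx : ContinuousOn x (Set.Icc 0 T)) (hxK : ∀ t ∈ Set.Icc 0 T, x t ≤ a + b * t + K * t ^ 2) :
    lam ^ 2 * (∫ t in (0 : ℝ)..T, Real.exp (-lam * t) * x t) - lam * a - b ≤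
      (2 * K + 2 * |a| + 4 * |b|) / lam := by
  have hlam0 : 0 < lam := by linarith
  have hT0 : 0 ≤ T := by linarith
  have hint : ∫ t in (0 : ℝ)..T, Real.exp (-lam * t) * x t ≤
      ∫ t in (0 : ℝ)..T, Real.exp (-lam * t) * (a + b * t + K * t ^ 2) := by
    refine intervalIntegral.integral_mono_on hT0 ?_
      (Continuous.intervalIntegrable (by fun_prop) _ _)
      (fun t ht => mul_le_mul_of_nonneg_left (hxK t ht) (Real.exp_pos _).le)
    refine ContinuousOn.intervalIntegrable ?_
    rw [Set.uIcc_of_le hT0]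
    exact (Continuous.continuousOn (by fun_prop)).mul hx
  rw [integral_exp_neg_mul_quadratic hlam0.ne'] at hint
  set E := Real.exp (-lam * T) with hE
  have hE0 : 0 < E := Real.exp_pos _
  have hEy : (lam * T) ^ 2 * E ≤ 2 := by
    rw [hE, neg_mul]
    exact sq_mul_exp_neg_le (by positivity)
  -- As `lam, T ≥ 1`, each boundary term at `T` is of order `1 / lam`.
  have h1 : lam ^ 2 * E ≤ 2 := by
    refine le_trans ?_ hEy
    rw [mul_pow]
    have : 1 ≤ T ^ 2 := one_le_pow₀ hT
    nlinarith [mul_pos (pow_pos hlam0 2) hE0]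
  have h2 : lam ^ 2 * T * E ≤ 2 := by
    refine le_trans ?_ hEy
    have : T ≤ T ^ 2 := by nlinarith
    rw [mul_pow]
    gcongr
  have h3 : lam * E ≤ 2 := by
    refine le_trans ?_ h1
    have : lam ≤ lam ^ 2 := by nlinarith
    gcongr
  have hneg : ∀ {r s : ℝ}, 0 ≤ s → s ≤ 2 → -(r * s) ≤ 2 * |r| := by
    intro r s hs0 hs2
    nlinarith [neg_abs_le r, abs_nonneg r]
  have e1 := hneg (r := a) (by positivity) h1
  have e2 := hneg (r := b) (by positivity) h2
  have e3 := hneg (r := b) (by positivity) h3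
  have e4 : 0 ≤ E * (lam ^ 2 * T ^ 2 + 2 * lam * T + 2) * K := by positivity
  rw [le_div_iff₀ hlam0]
  have hmul := mul_le_mul_of_nonneg_left hint (pow_pos hlam0 3).le
  have hexp : lam ^ 3 * (a / lam + b / lam ^ 2 + 2 * K / lam ^ 3 - E *
        ((a + b * T + K * T ^ 2) / lam + (b + 2 * K * T) / lam ^ 2 + 2 * K / lam ^ 3)) =
      lam ^ 2 * a + lam * b + 2 * K - a * (lam ^ 2 * E) - b * (lam ^ 2 * T * E) - b * (lam * E)
        - E * (lam ^ 2 * T ^ 2 + 2 * lam * T + 2) * K := by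
    field_simp
    ring
  rw [hexp] at hmul
  linarith

/-- The truncated Yosida approximation of the derivative at `0` of a scalar function: the Laplace
average reproduces the affine part `a + b * t` exactly up to exponentially small boundary terms at
`T`, and turns a quadratic remainder into an error of order `1 / lam`. -/
theorem abs_yosida_sub_le {x : ℝ → ℝ} {a b K lam T : ℝ} (hlam : 1 ≤ lam) (hT : 1 ≤ T)
    (hK : 0 ≤ K) (hx : ContinuousOn x (Set.Icc 0 T))
    (hxK : ∀ t ∈ Set.Icc 0 T, |x t - (a + b * t)| ≤ K * t ^ 2) :
    |lam ^ 2 * (∫ t in (0 : ℝ)..T, Real.exp (-lam * t) * x t) - lam * a - b| ≤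
      (2 * K + 2 * |a| + 4 * |b|) / lam := by
  have h1 := yosida_sub_le (a := a) (b := b) hlam hT hK hx
    (fun t ht => by linarith [(abs_le.1 (hxK t ht)).2])
  have h2 := yosida_sub_le (x := fun t => -x t) (a := -a) (b := -b) hlam hT hK hx.neg
    (fun t ht => by linarith [(abs_le.1 (hxK t ht)).1])
  simp only [mul_neg, intervalIntegral.integral_neg, abs_neg] at h2
  exact abs_le.2 ⟨by linarith, h1⟩

/-! ### Best uniform approximation by observables -/

namespace KoopmanId

variable {n m : ℕ}

theorem supNorm_le_ofReal_iff {M : Set (ExtState n m)} {h : ExtState n m → ℝ} {r : ℝ}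
    (hr : 0 ≤ r) : supNorm M h ≤ ENNReal.ofReal r ↔ ∀ z ∈ M, |h z| ≤ r := by
  simp only [supNorm, iSup_le_iff, Real.enorm_eq_ofReal_abs, ENNReal.ofReal_le_ofReal_iff hr]

/-- In a normed space, the combinations of finitely many vectors contain a best approximation of
any vector, even if the vectors are linearly dependent. -/
theorem exists_norm_sub_sum_smul_le {E : Type*} [NormedAddCommGroup E] [NormedSpace ℝ E] {N : ℕ}
    (Φ : Fin N → E) (h : E) :
    ∃ c : Fin N → ℝ, ∀ c' : Fin N → ℝ, ‖h - ∑ k, c k • Φ k‖ ≤ ‖h - ∑ k, c' k • Φ k‖ := by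
  let W : Submodule ℝ E := LinearMap.range (Fintype.linearCombination ℝ Φ)
  have : ProperSpace W := FiniteDimensional.proper ℝ W
  have hcoer : Tendsto (fun w : W => ‖h - w‖) (cocompact W) atTop := by
    refine tendsto_atTop_mono (fun w => ?_)
      (tendsto_atTop_add_const_right _ (-‖h‖) (tendsto_norm_cocompact_atTop (E := W)))
    have := norm_sub_norm_le (w : E) h
    rw [norm_sub_rev] at this
    simpa [sub_eq_add_neg] using this
  obtain ⟨⟨w, c, hc⟩, hw⟩ :=
    Continuous.exists_forall_le (f := fun w : W => ‖h - w‖) (by fun_prop) hcoer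
  refine ⟨c, fun c' => ?_⟩
  have := hw ⟨_, c', rfl⟩
  simp only [← hc] at this
  simpa only [Fintype.linearCombination_apply] using this

theorem continuous_observable (a : ObsIndex n m) : Continuous (observable a) := by
  unfold observable
  fun_prop

theorem observable_coordIndex (j : Fin n) (z : ExtState n m) :
    observable (coordIndex j) z = z.1 j := by
  simp [observable, coordIndex, Pi.single_apply, pow_ite]

/-- If the target is bounded on `M`, the problem takes place in the space `ℓ^∞(M)`; otherwise every
error is infinite and there is nothing to minimise. -/
theorem exists_supNorm_sub_obsSum_le {M : Set (ExtState n m)} (hM : IsCompact M)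
    (σ : ℕ → ObsIndex n m) (N : ℕ) (h : ExtState n m → ℝ) :
    ∃ c : Fin N → ℝ, ∀ c' : Fin N → ℝ,
      supNorm M (fun z => h z - obsSum σ c z) ≤ supNorm M (fun z => h z - obsSum σ c' z) := by
  have hobs : ∀ a : ObsIndex n m, ∃ B, ∀ z ∈ M, ‖observable a z‖ ≤ B := fun a =>
    hM.exists_bound_of_continuousOn (continuous_observable a).continuousOn
  by_cases hfin : ∃ B, ∀ z ∈ M, ‖h z‖ ≤ B
  · obtain ⟨B, hB⟩ := hfin
    let H : lp (fun _ : M => ℝ) ∞ := ⟨fun z => h z, memℓp_infty ⟨B, by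
      rintro _ ⟨z, rfl⟩; exact hB z z.2⟩⟩
    let Φ : Fin N → lp (fun _ : M => ℝ) ∞ := fun k => ⟨fun z => observable (σ k) z,
      memℓp_infty ⟨(hobs (σ k)).choose, by
        rintro _ ⟨z, rfl⟩; exact (hobs (σ k)).choose_spec z z.2⟩⟩
    have happ : ∀ (c : Fin N → ℝ) (z : M),
        (H - ∑ k, c k • Φ k : lp (fun _ : M => ℝ) ∞) z = h z - obsSum σ c z := by
      intro c z
      have hsub := congr_fun (lp.coeFn_sub H (∑ k, c k • Φ k)) z
      rw [Pi.sub_apply, lp.coeFn_sum, Finset.sum_apply] at hsub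
      refine hsub.trans (congrArg _ (Finset.sum_congr rfl fun k _ => ?_))
      exact mul_comm _ _
    obtain ⟨c, hc⟩ := exists_norm_sub_sum_smul_le Φ H
    refine ⟨c, fun c' => ?_⟩
    by_cases htop : supNorm M (fun z => h z - obsSum σ c' z) = ⊤
    · exact htop ▸ le_top
    have hle := (ENNReal.ofReal_toReal htop).ge
    rw [supNorm_le_ofReal_iff ENNReal.toReal_nonneg] at hle
    rw [← ENNReal.ofReal_toReal htop, supNorm_le_ofReal_iff ENNReal.toReal_nonneg]
    intro z hz
    have h1 := lp.norm_apply_le_norm ENNReal.top_ne_zero (H - ∑ k, c k • Φ k) ⟨z, hz⟩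
    rw [happ] at h1
    refine h1.trans ((hc c').trans (lp.norm_le_of_forall_le ENNReal.toReal_nonneg fun z => ?_))
    rw [happ]
    exact hle z z.2
  · refine ⟨0, fun c' => ?_⟩
    suffices supNorm M (fun z => h z - obsSum σ c' z) = ⊤ from this ▸ le_top
    by_contra htop
    have hle := (ENNReal.ofReal_toReal htop).ge
    rw [supNorm_le_ofReal_iff ENNReal.toReal_nonneg] at hle
    have hcont : Continuous (obsSum σ c') := by
      unfold obsSum
      exact continuous_finsetSum _ fun k _ => (continuous_observable _).mul continuous_const
    obtain ⟨B, hB⟩ := hM.exists_bound_of_continuousOn hcont.continuousOn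
    refine hfin ⟨(supNorm M (fun z => h z - obsSum σ c' z)).toReal + B, fun z hz => ?_⟩
    have := norm_add_le (h z - obsSum σ c' z) (obsSum σ c' z)
    rw [sub_add_cancel] at this
    exact this.trans (add_le_add (hle z hz) (hB z hz))

/-! ### Density of the observables that are affine in the input -/

/-- Polynomials in finitely many variables are uniformly dense on compact sets. -/
theorem exists_mvPolynomial_near {K : Set (EuclideanSpace ℝ (Fin n))} (hK : IsCompact K)
    {f : EuclideanSpace ℝ (Fin n) → ℝ} (hf : Continuous f) {ε : ℝ} (hε : 0 < ε) :
    ∃ p : MvPolynomial (Fin n) ℝ, ∀ x ∈ K, |MvPolynomial.eval (fun j => x j) p - f x| < ε := by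
  let X : Fin n → C(EuclideanSpace ℝ (Fin n), ℝ) := fun j => ⟨fun x => x j, by fun_prop⟩
  have hsep : (MvPolynomial.aeval (R := ℝ) X).range.SeparatesPoints := by
    intro x y hxy
    obtain ⟨j, hj⟩ : ∃ j, x j ≠ y j := by
      by_contra! h
      exact hxy (by ext j; exact h j)
    exact ⟨X j, ⟨X j, ⟨MvPolynomial.X j, by simp⟩, rfl⟩, hj⟩
  obtain ⟨_, ⟨p, rfl⟩, hp⟩ :=
    ContinuousMap.exists_mem_subalgebra_near_continuous_of_isCompact_of_separatesPoints
      hsep ⟨f, hf⟩ hK hε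
  have heval : ∀ (q : MvPolynomial (Fin n) ℝ) (x : EuclideanSpace ℝ (Fin n)),
      MvPolynomial.aeval X q x = MvPolynomial.eval (fun j => x j) q := by
    intro q x
    induction q using MvPolynomial.induction_on with
    | C a => simp
    | add p q hp hq => simp [hp, hq]
    | mul_X p j hp => simp [hp, X]
  exact ⟨p, fun x hx => by simpa [heval] using hp x hx⟩

theorem eval_mul_prod_mem_span (p : MvPolynomial (Fin n) ℝ) {q : Fin m → ℕ}
    (hq : ∑ l, q l ≤ 1) :
    (fun z : ExtState n m => MvPolynomial.eval (fun j => z.1 j) p * ∏ l, z.2 l ^ q l) ∈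
      Submodule.span ℝ (Set.range (observable (n := n) (m := m))) := by
  have h : (fun z : ExtState n m => MvPolynomial.eval (fun j => z.1 j) p * ∏ l, z.2 l ^ q l) =
      ∑ d ∈ p.support, p.coeff d • observable ⟨(d, q), hq⟩ := by
    ext z
    simp only [MvPolynomial.eval_eq', observable, Finset.sum_apply, Pi.smul_apply, smul_eq_mul,
      Finset.sum_mul, mul_assoc]
  rw [h]
  exact Submodule.sum_mem _ fun d _ =>
    Submodule.smul_mem _ _ (Submodule.subset_span ⟨_, rfl⟩)

/-- The approximation of the right-hand side uses only observables that are affine in the input,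
because the field itself is. -/
theorem exists_mem_span_near_vectorField {f : EuclideanSpace ℝ (Fin n) → EuclideanSpace ℝ (Fin n)}
    {g : EuclideanSpace ℝ (Fin n) → Matrix (Fin n) (Fin m) ℝ} (hf : Continuous f)
    (hg : ∀ i j, Continuous (fun x => g x i j)) {M : Set (ExtState n m)} (hM : IsCompact M)
    (j : Fin n) {ε : ℝ} (hε : 0 < ε) :
    ∃ P ∈ Submodule.span ℝ (Set.range (observable (n := n) (m := m))),
      ∀ z ∈ M, |P z - vectorField f g z j| ≤ ε := by
  obtain ⟨B, hB⟩ := hM.exists_bound_of_continuousOn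
    (continuous_snd (X := EuclideanSpace ℝ (Fin n)) (Y := EuclideanSpace ℝ (Fin m))).continuousOn
  have hK := hM.image continuous_fst
  -- One error of size at most `δ` comes from `f`, and `m` errors of size at most `δ * |B|` from the
  -- columns of `g`.
  set δ := ε / (1 + m * |B|) with hδdef
  have hδ : 0 < δ := by positivity
  obtain ⟨p, hp⟩ := exists_mvPolynomial_near hK (f := fun x => f x j) (by fun_prop) hδ
  choose r hr using fun l => exists_mvPolynomial_near hK (hg j l) hδ
  let P : ExtState n m → ℝ :=
    (fun z => MvPolynomial.eval (fun j => z.1 j) p * ∏ l, z.2 l ^ (0 : Fin m → ℕ) l) +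
    ∑ l, fun z => MvPolynomial.eval (fun j => z.1 j) (r l) *
      ∏ l', z.2 l' ^ (Pi.single l 1 : Fin m → ℕ) l'
  have hP : P ∈ Submodule.span ℝ (Set.range (observable (n := n) (m := m))) :=
    Submodule.add_mem _ (eval_mul_prod_mem_span p (by simp))
      (Submodule.sum_mem _ fun l _ => eval_mul_prod_mem_span (r l) (by simp))
  have hPz : ∀ z, P z = MvPolynomial.eval (fun j => z.1 j) p +
      ∑ l, MvPolynomial.eval (fun j => z.1 j) (r l) * z.2 l := by
    intro z
    simp [P, Pi.single_apply, pow_ite]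
  refine ⟨P, hP, fun z hz => ?_⟩
  have hzK : z.1 ∈ Prod.fst '' M := ⟨z, hz, rfl⟩
  have hdiff : P z - vectorField f g z j =
      (MvPolynomial.eval (fun j => z.1 j) p - f z.1 j) +
        ∑ l, (MvPolynomial.eval (fun j => z.1 j) (r l) - g z.1 j l) * z.2 l := by
    have hv : vectorField f g z j = f z.1 j + ∑ l, g z.1 j l * z.2 l := rfl
    simp only [hPz, hv, sub_mul, Finset.sum_sub_distrib]
    ring
  rw [hdiff]
  have hterm : ∀ l, |(MvPolynomial.eval (fun j => z.1 j) (r l) - g z.1 j l) * z.2 l| ≤ δ * |B| := by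
    intro l
    rw [abs_mul]
    have h2 : |z.2 l| ≤ |B| :=
      (PiLp.norm_apply_le z.2 l).trans ((hB z hz).trans (le_abs_self B))
    have h1 := (hr l z.1 hzK).le
    gcongr
  calc _ ≤ |MvPolynomial.eval (fun j => z.1 j) p - f z.1 j| +
        ∑ l, |(MvPolynomial.eval (fun j => z.1 j) (r l) - g z.1 j l) * z.2 l| :=
        (abs_add_le _ _).trans (add_le_add le_rfl (Finset.abs_sum_le_sum_abs _ _))
    _ ≤ δ + ∑ _l : Fin m, δ * |B| :=
        add_le_add (hp z.1 hzK).le (Finset.sum_le_sum fun l _ => hterm l)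
    _ = δ * (1 + m * |B|) := by simp; ring
    _ = ε := by rw [hδdef]; field_simp

theorem eventually_exists_obsSum_eq {σ : ℕ → ObsIndex n m} (hσ : Function.Surjective σ)
    {P : ExtState n m → ℝ} (hP : P ∈ Submodule.span ℝ (Set.range (observable (n := n) (m := m)))) :
    ∀ᶠ N : ℕ in atTop, ∃ c : Fin N → ℝ, obsSum σ c = P := by
  rw [← hσ.range_comp, Finsupp.mem_span_range_iff_exists_finsupp] at hP
  obtain ⟨c, rfl⟩ := hP
  obtain ⟨N₀, hN₀⟩ := c.support.exists_nat_subset_range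
  filter_upwards [eventually_ge_atTop N₀] with N hN
  refine ⟨fun k => c k, ?_⟩
  ext z
  rw [Finsupp.sum_of_support_subset c (hN₀.trans (Finset.range_subset_range.2 hN)) _ (by simp),
    Finset.sum_apply, obsSum, Fin.sum_univ_eq_sum_range (fun k => observable (σ k) z * c k) N]
  simp [mul_comm]

end KoopmanId

/-! ### Convergence of the recovered field -/

namespace KoopmanId

variable {n m : ℕ}

/-- The truncated Yosida approximation, applied to the coordinates, recovers the field at rate
`1 / lam`, uniformly over the invariant set and the truncation times `T ≥ 1`. -/
theorem exists_abs_yosidaTrunc_sub_le {V : ExtState n m → ExtState n m} (hV : LocallyLipschitz V)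
    {M : Set (ExtState n m)} (hM : IsCompact M) (hinv : IsInvariantSet V M) :
    ∃ C : ℝ, ∀ lam T : ℝ, 1 ≤ lam → 1 ≤ T → ∀ z ∈ M, ∀ j,
      |yosidaTrunc V lam T (observable (coordIndex j)) z - (V z).1 j| ≤ C / lam := by
  obtain ⟨K, hK, hflow⟩ := exists_norm_flow_sub_le hV hM hinv
  obtain ⟨B, hB⟩ := hM.exists_bound_of_continuousOn (f := id) continuousOn_id
  obtain ⟨D, hD⟩ := hM.exists_bound_of_continuousOn hV.continuous.continuousOn
  have hcoord : ∀ (w : ExtState n m) j, |w.1 j| ≤ ‖w‖ := fun w j =>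
    (PiLp.norm_apply_le w.1 j).trans (norm_fst_le w)
  refine ⟨2 * K + 2 * B + 4 * D, fun lam T hlam hT z hz j => ?_⟩
  have hcont : ContinuousOn (fun t => (flow V t z).1 j) (Set.Icc 0 T) := by
    have h : ContinuousOn (fun t => flow V t z) (Set.Icc 0 T) := fun t ht =>
      (((hinv.isForwardSolution_flow hV hz).1.2 t ht.1).continuousWithinAt).mono
        Set.Icc_subset_Ici_self
    exact (PiLp.continuous_apply 2 _ j).comp_continuousOn (continuous_fst.comp_continuousOn h)
  have h := abs_yosida_sub_le (a := z.1 j) (b := (V z).1 j) hlam hT hK hcont fun t ht => by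
    refine le_trans (le_of_eq ?_) ((hcoord (flow V t z - (z + t • V z)) j).trans
      (hflow z hz t ht.1))
    simp [mul_comm]
  simp only [yosidaTrunc, koopman, observable_coordIndex]
  refine h.trans ?_
  have h1 := (hcoord z j).trans (hB z hz)
  have h2 := (hcoord (V z) j).trans (hD z hz)
  gcongr

/-- Best approximation costs at most twice the error of the generator: the distance from the
recovered component to the true one is at most the distance from the true one to `𝓕_N`, plus twice
the error of the truncated Yosida approximation. -/
theorem abs_recoveredField_sub_le {V : ExtState n m → ExtState n m} {M : Set (ExtState n m)}
    {σ : ℕ → ObsIndex n m} {lam T : ℝ} {N : ℕ} {A : Matrix (Fin N) (Fin N) ℝ}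
    (hA : IsFiniteDimApprox V M σ lam T N A) {j : Fin n} (hj : ∃ i : Fin N, σ i = coordIndex j)
    {F : ExtState n m → ℝ} {δ η : ℝ}
    (hF : ∀ z ∈ M, |yosidaTrunc V lam T (observable (coordIndex j)) z - F z| ≤ δ)
    {c : Fin N → ℝ} (hc : ∀ z ∈ M, |obsSum σ c z - F z| ≤ η) {z : ExtState n m} (hz : z ∈ M) :
    |recoveredField σ A z j - F z| ≤ η + 2 * δ := by
  have hbest := hA hj.choose c
  rw [hj.choose_spec] at hbest
  have hδη : 0 ≤ δ + η := add_nonneg ((abs_nonneg _).trans (hF z hz))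
    ((abs_nonneg _).trans (hc z hz))
  have hle := hbest.trans ((supNorm_le_ofReal_iff hδη).2 fun w hw => by
    have h1 := abs_le.1 (hF w hw)
    have h2 := abs_le.1 (hc w hw)
    exact abs_le.2 ⟨by linarith, by linarith⟩)
  have h1 := abs_le.1 ((supNorm_le_ofReal_iff hδη).1 hle z hz)
  have h2 := abs_le.1 (hF z hz)
  have hrec : recoveredField σ A z j = obsSum σ (fun k => A k hj.choose) z := by
    simp only [recoveredField, dif_pos hj]
  rw [hrec]
  exact abs_le.2 ⟨by linarith, by linarith⟩

theorem tendstoUniformlyOn_of_forall_coord {ι α : Type*} {l : Filter ι} {s : Set α}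
    {G : ι → α → EuclideanSpace ℝ (Fin n)} {F : α → EuclideanSpace ℝ (Fin n)}
    (h : ∀ j, ∀ ε > 0, ∀ᶠ p in l, ∀ z ∈ s, |G p z j - F z j| ≤ ε) :
    TendstoUniformlyOn G F l s := by
  rw [Metric.tendstoUniformlyOn_iff]
  intro ε hε
  have hδ : 0 < ε / (n + 1) := by positivity
  filter_upwards [eventually_all.2 fun j => h j _ hδ] with p hp z hz
  rw [dist_comm, dist_eq_norm]
  refine lt_of_pow_lt_pow_left₀ 2 hε.le ?_
  calc ‖G p z - F z‖ ^ 2 = ∑ j, |G p z j - F z j| ^ 2 := by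
        rw [EuclideanSpace.norm_sq_eq]; rfl
    _ ≤ ∑ _j : Fin n, (ε / (n + 1)) ^ 2 :=
        Finset.sum_le_sum fun j _ => pow_le_pow_left₀ (abs_nonneg _) (hp j z hz) 2
    _ = n * (ε / (n + 1)) ^ 2 := by simp
    _ < (n + 1) ^ 2 * (ε / (n + 1)) ^ 2 := by
        gcongr
        nlinarith [(Nat.cast_nonneg n : (0 : ℝ) ≤ n)]
    _ = ε ^ 2 := by field_simp

end KoopmanId

open KoopmanId in
theorem theorem1 (n m : ℕ)
    (f : EuclideanSpace ℝ (Fin n) → EuclideanSpace ℝ (Fin n))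
    (g : EuclideanSpace ℝ (Fin n) → Matrix (Fin n) (Fin m) ℝ)
    (hf : ContDiff ℝ 1 f) (hg : ∀ i j, ContDiff ℝ ∞ (fun x => g x i j))
    (M : Set (ExtState n m)) (hM : IsCompact M) (hinv : IsInvariantSet (extField f g) M)
    (σ : ℕ → ObsIndex n m) (hσ : Function.Bijective σ) :
    (∀ (lam T : ℝ) (N : ℕ), 0 < lam → 0 < T →
      ∃ A : Matrix (Fin N) (Fin N) ℝ, IsFiniteDimApprox (extField f g) M σ lam T N A) ∧
    ∀ A : ℝ → ℝ → (N : ℕ) → Matrix (Fin N) (Fin N) ℝ,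
      (∀ (lam T : ℝ) (N : ℕ), 0 < lam → 0 < T →
        IsFiniteDimApprox (extField f g) M σ lam T N (A lam T N)) →
      TendstoUniformlyOn
        (fun (p : ℝ × ℝ × ℕ) (z : ExtState n m) => recoveredField σ (A p.1 p.2.1 p.2.2) z)
        (vectorField f g) (atTop ×ˢ atTop ×ˢ atTop) M := by
  constructor
  · intro lam T N _ _
    choose c hc using fun i : Fin N => exists_supNorm_sub_obsSum_le hM σ N
      (yosidaTrunc (extField f g) lam T (observable (σ i)))
    exact ⟨fun k i => c i k, hc⟩
  · intro A hA
    have hV : LocallyLipschitz (extField f g) :=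
      ((contDiff_vectorField hf fun i j => (hg i j).of_le (by norm_cast)).prodMk
        contDiff_const).locallyLipschitz
    obtain ⟨C, hC⟩ := exists_abs_yosidaTrunc_sub_le hV hM hinv
    refine tendstoUniformlyOn_of_forall_coord fun j ε hε => ?_
    obtain ⟨P, hP, hPF⟩ := exists_mem_span_near_vectorField hf.continuous
      (fun i j => (hg i j).continuous) hM j (half_pos hε)
    obtain ⟨i, hi⟩ := hσ.surjective (coordIndex j)
    have hlam : ∀ᶠ lam : ℝ in atTop, 1 ≤ lam ∧ C / lam ≤ ε / 4 :=
      (eventually_ge_atTop 1).and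
        ((tendsto_const_nhds.div_atTop tendsto_id).eventually_le_const (by positivity))
    have hN := (eventually_gt_atTop i).and (eventually_exists_obsSum_eq hσ.surjective hP)
    filter_upwards [hlam.prod_mk ((eventually_ge_atTop (1 : ℝ)).prod_mk hN)]
    rintro ⟨lam, T, N⟩ ⟨⟨hlam1, hlamC⟩, hT, hiN, c, hc⟩ z hz
    dsimp only at hlam1 hlamC hT hiN c hc ⊢
    refine (abs_recoveredField_sub_le (hA lam T N (by linarith) (by linarith)) ⟨⟨i, hiN⟩, hi⟩
      (F := fun z => vectorField f g z j)
      (fun w hw => (hC lam T hlam1 hT w hw j).trans hlamC)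
      (c := c) (fun w hw => hc ▸ hPF w hw) hz).trans ?_
    linarith
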